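/- Let $\gamma>0$ and $\mathbf{x}\in\mathbb{R}^3$ be fixed. Let $s(\gamma)$ be the sign of $\cos(\tfrac{\pi}{2}\gamma)$ if $\cos(\tfrac{\pi}{2}\gamma)\neq 0$, and let $s(\gamma)=1$ if $\cos(\tfrac{\pi}{2}\gamma)=0$. For $\omega\in\mathbb{R}$ let $(-i\omega)^\gamma$ denote the principal power ($z^\gamma=e^{\gamma\log z}$, with $0^\gamma=0$), and let $\mathcal{F}$ be the Fourier transform on the tempered distributions $\mathcal{S}'(\mathbb{R})$, given by $\langle \mathcal{F}T,\varphi\rangle=\langle T,\mathcal{F}\varphi\rangle$ and $\mathcal{F}(\varphi)(\omega)=\frac{1}{\sqrt{2\pi}}\int_{\mathbb{R}}e^{-i\omega t}\varphi(t)\,dt$ for $\varphi\in\mathcal{S}(\mathbb{R})$. A tempered distribution on $\mathbb{R}$ is called causal if its support is contained in $[0,\infty)$. The functions $\omega\mapsto(-i\omega)^\gamma$ and $\omega\mapsto e^{-s(\gamma)(-i\omega)^\gamma|\mathbf{x}|}$ are measurable and polynomially bounded, hence define tempered distributions, and: 1. the distribution $\mathcal{F}\big((-i\omega)^\gamma\big)$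 is causal; 2. if $\gamma\in(0,1]$, the distribution $\mathcal{F}\big(e^{-s(\gamma)(-i\omega)^\gamma|\mathbf{x}|}\big)$ is causal; 3. if $\gamma>1$ and $\mathbf{x}\neq \mathbf{0}$, the distribution $\mathcal{F}\big(e^{-s(\gamma)(-i\omega)^\gamma|\mathbf{x}|}\big)$ is not causal. -/

import Mathlib

open MeasureTheory
open scoped SchwartzMap FourierTransform

noncomputable section

namespace CausalDistribution

/-- A measurable, polynomially bounded (slowly increasing) function on the line. -/
def IsSlowlyIncreasing (f : ℝ → ℂ) : Prop :=
  AEStronglyMeasurable f volume ∧ ∃ (C : ℝ) (k : ℕ), ∀ ω : ℝ, ‖f ω‖ ≤ C * (1 + ‖ω‖) ^ k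

lemma exists_integrable_bound {f : ℝ → ℂ} (hf : IsSlowlyIncreasing f) :
    ∃ (s : Finset (ℕ × ℕ)) (g : ℝ → ℝ), Integrable g ∧ (∀ ω, 0 ≤ g ω) ∧
      ∀ (φ : 𝓢(ℝ, ℂ)) (ω : ℝ),
        ‖φ ω * f ω‖ ≤ g ω * s.sup (schwartzSeminormFamily ℂ ℝ ℂ) φ := by
  obtain ⟨-, C, k, hC⟩ := hf
  have hC0 : 0 ≤ C := by simpa using (norm_nonneg _).trans (hC 0)
  obtain ⟨n, hn⟩ := (inferInstance : (volume : Measure ℝ).HasTemperateGrowth).exists_integrable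
  refine ⟨Finset.Iic (n + k, 0), fun ω => (1 + ‖ω‖) ^ (-(n : ℝ)) * (C * 2 ^ (n + k)),
    hn.mul_const _, fun ω => by positivity, fun φ ω => ?_⟩
  have h := SchwartzMap.one_add_le_sup_seminorm_apply (𝕜 := ℂ) (m := (n + k, 0))
    (k := n + k) (n := 0) le_rfl le_rfl φ ω
  rw [norm_iteratedFDeriv_zero] at h
  have hpos : 0 < (1 + ‖ω‖) ^ n := by positivity
  beta_reduce
  rw [Real.rpow_neg (by positivity), Real.rpow_natCast, norm_mul, mul_assoc,
    ← div_eq_inv_mul, le_div_iff₀' hpos]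
  calc (1 + ‖ω‖) ^ n * (‖φ ω‖ * ‖f ω‖)
      ≤ (1 + ‖ω‖) ^ n * (‖φ ω‖ * (C * (1 + ‖ω‖) ^ k)) := by gcongr; exact hC ω
    _ = C * ((1 + ‖ω‖) ^ (n + k) * ‖φ ω‖) := by ring
    _ ≤ C * (2 ^ (n + k) *
          (Finset.Iic (n + k, 0)).sup (fun m => SchwartzMap.seminorm ℂ m.1 m.2) φ) := by
        gcongr
    _ = _ := by unfold schwartzSeminormFamily; ring

lemma integrable_mul {f : ℝ → ℂ} (hf : IsSlowlyIncreasing f) (φ : 𝓢(ℝ, ℂ)) :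
    Integrable (fun ω : ℝ => φ ω * f ω) := by
  obtain ⟨s, g, hg, -, hb⟩ := exists_integrable_bound hf
  exact (hg.mul_const _).mono' (φ.continuous.aestronglyMeasurable.mul hf.1)
    (Filter.Eventually.of_forall (hb φ))

/-- The tempered distribution `φ ↦ ∫ φ(ω) f(ω) dω` of a slowly increasing function `f`. -/
def ofFunction (f : ℝ → ℂ) (hf : IsSlowlyIncreasing f) : 𝓢'(ℝ, ℂ) :=
  ContinuousLinearMap.toPointwiseConvergenceCLM _ _ _ _ <|
    SchwartzMap.mkCLMtoNormedSpace (𝕜 := ℂ) (σ := RingHom.id ℂ)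
      (fun φ : 𝓢(ℝ, ℂ) => ∫ ω : ℝ, φ ω * f ω)
      (fun φ ψ => by
        simp only [add_apply, add_mul]
        exact integral_add (integrable_mul hf φ) (integrable_mul hf ψ))
      (fun a φ => by
        simp only [smul_apply, smul_eq_mul, mul_assoc, RingHom.id_apply]
        exact integral_const_mul a _)
      (by
        obtain ⟨s, g, hg, hg0, hb⟩ := exists_integrable_bound hf
        refine ⟨s, ∫ ω, g ω, integral_nonneg hg0, fun φ => ?_⟩
        rw [← integral_mul_const]
        exact norm_integral_le_of_norm_le (hg.mul_const _)
          (Filter.Eventually.of_forall (hb φ)))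

lemma ofFunction_apply (f : ℝ → ℂ) (hf : IsSlowlyIncreasing f) (φ : 𝓢(ℝ, ℂ)) :
    ofFunction f hf φ = ∫ ω : ℝ, φ ω * f ω := rfl

/-- Multiplication by `(2π)⁻¹` as a linear automorphism of the line. -/
def scaling : ℝ ≃L[ℝ] ℝ :=
  ContinuousLinearEquiv.unitsEquivAut ℝ
    (Units.mk0 (2 * Real.pi)⁻¹ (inv_ne_zero Real.two_pi_pos.ne'))

/-- The unitary Fourier transform with angular frequency on Schwartz functions,
`F(φ)(ω) = (2π)^(-1/2) ∫ exp(-iωt) φ(t) dt`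
(see `angularFourierSchwartz_apply`). -/
def angularFourierSchwartz : 𝓢(ℝ, ℂ) →L[ℂ] 𝓢(ℝ, ℂ) :=
  ((Real.sqrt (2 * Real.pi) : ℂ)⁻¹) •
    (SchwartzMap.compCLMOfContinuousLinearEquiv ℂ scaling ∘L
      FourierTransform.fourierCLM ℂ 𝓢(ℝ, ℂ))

lemma angularFourierSchwartz_apply (φ : 𝓢(ℝ, ℂ)) (ω : ℝ) :
    angularFourierSchwartz φ ω =
      (Real.sqrt (2 * Real.pi) : ℂ)⁻¹ *
        ∫ t : ℝ, Complex.exp (-Complex.I * (ω : ℂ) * (t : ℂ)) * φ t := by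
  have h : scaling ω = ω * (2 * Real.pi)⁻¹ := by simp [scaling]
  have h2 : (Real.pi : ℂ) ≠ 0 := by exact_mod_cast Real.pi_ne_zero
  change (Real.sqrt (2 * Real.pi) : ℂ)⁻¹ * (𝓕 φ) (scaling ω) = _
  rw [h, SchwartzMap.fourier_coe, Real.fourier_real_eq_integral_exp_smul]
  congr 1
  refine integral_congr_ae (Filter.Eventually.of_forall fun t => ?_)
  simp only [smul_eq_mul]
  congr 2
  push_cast
  field_simp

/-- The Fourier transform of a tempered distribution, `⟨F T, φ⟩ = ⟨T, F φ⟩`, in the unitary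
angular-frequency normalization. -/
def angularFourier (T : 𝓢'(ℝ, ℂ)) : 𝓢'(ℝ, ℂ) :=
  PointwiseConvergenceCLM.precomp ℂ angularFourierSchwartz T

lemma angularFourier_apply (T : 𝓢'(ℝ, ℂ)) (φ : 𝓢(ℝ, ℂ)) :
    angularFourier T φ = T (angularFourierSchwartz φ) := rfl

/-- A tempered distribution on the line is causal if its support lies in `[0, ∞)`. -/
def IsCausal (T : 𝓢'(ℝ, ℂ)) : Prop :=
  Distribution.dsupport T ⊆ Set.Ici 0

/-- The sign of `cos (π γ / 2)`, with the value `1` where the cosine vanishes. -/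
def cosSign (γ : ℝ) : ℝ :=
  if Real.cos (Real.pi / 2 * γ) = 0 then 1 else Real.sign (Real.cos (Real.pi / 2 * γ))

/-- The function `ω ↦ (-iω)^γ`, with the principal branch of the power. -/
def powerSymbol (γ : ℝ) (ω : ℝ) : ℂ :=
  (-Complex.I * (ω : ℂ)) ^ (γ : ℂ)

/-- The function `ω ↦ exp(-s(γ) (-iω)^γ r)`, where `s(γ)` is `cosSign γ`. -/
def attenuationSymbol (γ r : ℝ) (ω : ℝ) : ℂ :=
  Complex.exp (-(cosSign γ : ℂ) * powerSymbol γ ω * (r : ℂ))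

lemma measurable_powerSymbol (γ : ℝ) : Measurable (powerSymbol γ) := by
  unfold powerSymbol
  fun_prop

lemma norm_powerSymbol {γ : ℝ} (hγ : 0 < γ) (ω : ℝ) : ‖powerSymbol γ ω‖ = |ω| ^ γ := by
  rcases eq_or_ne ω 0 with rfl | h
  · have : (γ : ℂ) ≠ 0 := by exact_mod_cast hγ.ne'
    simp [powerSymbol, Complex.zero_cpow this, Real.zero_rpow hγ.ne']
  · rw [powerSymbol, Complex.norm_cpow_of_ne_zero (by simp [h])]
    simp

lemma isSlowlyIncreasing_powerSymbol {γ : ℝ} (hγ : 0 < γ) :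
    IsSlowlyIncreasing (powerSymbol γ) := by
  refine ⟨(measurable_powerSymbol γ).aestronglyMeasurable, 1, ⌈γ⌉₊, fun ω => ?_⟩
  rw [norm_powerSymbol hγ, one_mul, Real.norm_eq_abs, ← Real.rpow_natCast]
  calc |ω| ^ γ ≤ (1 + |ω|) ^ γ := by gcongr; linarith
    _ ≤ _ := Real.rpow_le_rpow_of_exponent_le (by linarith [abs_nonneg ω]) (Nat.le_ceil γ)

lemma powerSymbol_re {γ : ℝ} (hγ : 0 < γ) (ω : ℝ) :
    (powerSymbol γ ω).re = |ω| ^ γ * Real.cos (Real.pi / 2 * γ) := by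
  have hγ' : (γ : ℂ) ≠ 0 := by exact_mod_cast hγ.ne'
  rcases eq_or_ne ω 0 with rfl | h
  · simp [powerSymbol, Complex.zero_cpow hγ', Real.zero_rpow hγ.ne']
  have hz : -Complex.I * (ω : ℂ) ≠ 0 := by simp [h]
  have hcos : Real.cos (Complex.arg (-Complex.I * (ω : ℂ)) * γ) =
      Real.cos (Real.pi / 2 * γ) := by
    rcases h.lt_or_gt with h | h
    · have e : -Complex.I * (ω : ℂ) = ((-ω : ℝ) : ℂ) * Complex.I := by push_cast; ring
      rw [e, Complex.arg_real_mul _ (by linarith), Complex.arg_I]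
    · rw [mul_comm, mul_comm (-Complex.I), Complex.arg_real_mul _ h, Complex.arg_neg_I,
        mul_neg, Real.cos_neg, mul_comm]
  rw [powerSymbol, Complex.cpow_def_of_ne_zero hz, Complex.exp_re, Complex.re_mul_ofReal,
    Complex.im_mul_ofReal, Complex.log_re, Complex.log_im, hcos,
    Real.rpow_def_of_pos (abs_pos.mpr h)]
  simp

lemma norm_attenuationSymbol_le {γ : ℝ} (hγ : 0 < γ) {r : ℝ} (hr : 0 ≤ r) (ω : ℝ) :
    ‖attenuationSymbol γ r ω‖ ≤ 1 := by
  have hs : 0 ≤ cosSign γ * Real.cos (Real.pi / 2 * γ) := by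
    unfold cosSign
    split_ifs with h
    · simp [h]
    · exact Real.sign_mul_nonneg _
  rw [attenuationSymbol, Complex.norm_exp, Real.exp_le_one_iff, Complex.re_mul_ofReal,
    ← Complex.ofReal_neg, Complex.re_ofReal_mul, powerSymbol_re hγ]
  have : 0 ≤ |ω| ^ γ * (cosSign γ * Real.cos (Real.pi / 2 * γ)) * r := by positivity
  linarith

lemma isSlowlyIncreasing_attenuationSymbol {γ : ℝ} (hγ : 0 < γ) {r : ℝ} (hr : 0 ≤ r) :
    IsSlowlyIncreasing (attenuationSymbol γ r) := by
  refine ⟨Measurable.aestronglyMeasurable ?_, 1, 0, fun ω => by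
    simpa using norm_attenuationSymbol_le hγ hr ω⟩
  have := measurable_powerSymbol γ
  unfold attenuationSymbol
  fun_prop

end CausalDistribution

end

open CausalDistribution

noncomputable section

open Set Filter Topology
open scoped ContDiff

namespace CausalDistribution

/-! Since `|exp(-iwt)| = exp(t Im w)`, a test function supported in `t < 0` has a Fourier–Laplace
transform that is bounded and rapidly decreasing on the upper half-plane. If the symbol extends
there holomorphically with polynomial growth, the line of integration in the pairing can be pushed
to `+i∞`, so the pairing vanishes (`isCausal_of_holomorphic_extension`). This covers `(-iz)^γ`,
because `Re(-iz) = Im z ≥ 0` avoids the branch cut. It covers the exponential for `γ ≤ 1`, because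
then `Re (-iz)^γ ≥ 0`.

For `γ > 1` the obstruction is analyticity (`not_isCausal_of_strip_extension`). If the symbol decays
faster than every exponential, its transform is entire; vanishing near one negative point would
force it, and hence the symbol, to be zero. When `cos(πγ/2) ≠ 0` this decay holds on the real line.
When the cosine vanishes, `γ = 2k+1` and the symbol is unimodular there, but one unit off the axis,
on the side of sign `(-1)^k`, it decays superexponentially (`exists_re_pow_odd_lower_bound`).
Shifting the line to that edge multiplies the transform only by a nonvanishing factor `exp(bt)`. -/

/-- The Fourier–Laplace transform `w ↦ ∫ exp(-iwt) g(t) dt` at complex frequencies. -/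
def fourierLaplace (g : ℝ → ℂ) (w : ℂ) : ℂ :=
  ∫ t : ℝ, Complex.exp (-Complex.I * w * (t : ℂ)) * g t

/-! ### Exponential moments and entire Fourier–Laplace transforms -/

/-- All exponential moments of `g` are finite. -/
structure HasExpMoments (g : ℝ → ℂ) : Prop where
  aestronglyMeasurable : AEStronglyMeasurable g volume
  integrable : ∀ K : ℝ, Integrable (fun t : ℝ => Real.exp (K * |t|) * ‖g t‖)

lemma norm_exp_kernel (w : ℂ) (t : ℝ) :
    ‖Complex.exp (-Complex.I * w * (t : ℂ))‖ = Real.exp (w.im * t) := by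
  rw [Complex.norm_exp]; simp

lemma norm_exp_kernel_le {w : ℂ} {B : ℝ} (hw : |w.im| ≤ B) (t : ℝ) :
    ‖Complex.exp (-Complex.I * w * (t : ℂ))‖ ≤ Real.exp (B * |t|) := by
  rw [norm_exp_kernel, Real.exp_le_exp]
  calc w.im * t ≤ |w.im| * |t| := by rw [← abs_mul]; exact le_abs_self _
    _ ≤ _ := by gcongr

lemma continuous_exp_kernel (w : ℂ) :
    Continuous fun t : ℝ => Complex.exp (-Complex.I * w * (t : ℂ)) := by
  fun_prop

namespace HasExpMoments

variable {g : ℝ → ℂ}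

lemma integrable_kernel_mul (hg : HasExpMoments g) (w : ℂ) :
    Integrable fun t : ℝ => Complex.exp (-Complex.I * w * (t : ℂ)) * g t := by
  refine (hg.integrable |w.im|).mono'
    ((continuous_exp_kernel w).aestronglyMeasurable.mul hg.aestronglyMeasurable)
    (Eventually.of_forall fun t => ?_)
  rw [norm_mul]
  gcongr
  exact norm_exp_kernel_le le_rfl t

lemma integrable_self (hg : HasExpMoments g) : Integrable g := by
  simpa using hg.integrable_kernel_mul 0

lemma differentiable_fourierLaplace (hg : HasExpMoments g) :
    Differentiable ℂ (fourierLaplace g) := by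
  intro w₀
  -- `B` bounds `|Im w|` on the unit ball around `w₀`; the further `+ 1` in the dominating exponent
  -- absorbs the factor `|t|` from differentiating the kernel.
  set B := |w₀.im| + 1
  have key := hasDerivAt_integral_of_dominated_loc_of_deriv_le (𝕜 := ℂ) (μ := volume)
    (F := fun (w : ℂ) (t : ℝ) => Complex.exp (-Complex.I * w * (t : ℂ)) * g t)
    (F' := fun (w : ℂ) (t : ℝ) =>
      Complex.exp (-Complex.I * w * (t : ℂ)) * (-Complex.I * (t : ℂ)) * g t)
    (bound := fun t => Real.exp ((B + 1) * |t|) * ‖g t‖) (x₀ := w₀)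
    (s := Metric.ball w₀ 1) (Metric.ball_mem_nhds w₀ one_pos)
    (Eventually.of_forall fun w => (hg.integrable_kernel_mul w).aestronglyMeasurable)
    (hg.integrable_kernel_mul w₀)
    ((by fun_prop : Continuous fun t : ℝ => Complex.exp (-Complex.I * w₀ * (t : ℂ)) *
      (-Complex.I * (t : ℂ))).aestronglyMeasurable.mul hg.aestronglyMeasurable)
    (Eventually.of_forall fun t w hw => ?_)
    (hg.integrable (B + 1))
    (Eventually.of_forall fun t w _ => ?_)
  · exact key.2.differentiableAt
  · have h1 : |w.im| ≤ B := by
      have h2 : |(w - w₀).im| ≤ 1 :=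
        (Complex.abs_im_le_norm _).trans (mem_ball_iff_norm.mp hw).le
      have h3 := abs_sub_abs_le_abs_sub w.im w₀.im
      rw [Complex.sub_im] at h2
      simp only [B]; linarith
    rw [norm_mul, norm_mul]
    gcongr
    rw [add_mul, Real.exp_add]
    have h4 : ‖-Complex.I * (t : ℂ)‖ ≤ Real.exp (1 * |t|) := by
      have := Real.add_one_le_exp |t|
      simp only [norm_mul, norm_neg, Complex.norm_I, Complex.norm_real, Real.norm_eq_abs]
      rw [one_mul]
      linarith
    gcongr
    exact norm_exp_kernel_le h1 t
  · have h : HasDerivAt (fun w : ℂ => -Complex.I * w * (t : ℂ)) (-Complex.I * (t : ℂ)) w := by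
      simpa using ((hasDerivAt_id w).const_mul (-Complex.I)).mul_const (t : ℂ)
    exact h.cexp.mul_const (g t)

lemma of_exp_bound (hg : Continuous g)
    (h : ∀ K : ℝ, ∃ C : ℝ, ∀ t : ℝ, ‖g t‖ ≤ C * Real.exp (-K * |t|)) : HasExpMoments g := by
  refine ⟨hg.aestronglyMeasurable, fun K => ?_⟩
  -- The surplus `exp(-2|t|)` is at most `(1 + |t|)^(-2)`, which is integrable.
  obtain ⟨C, hC⟩ := h (K + 2)
  have hC0 : 0 ≤ C := by simpa using (norm_nonneg _).trans (hC 0)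
  have hint : Integrable (fun x : ℝ => (1 + ‖x‖) ^ (-(2 : ℝ))) :=
    integrable_one_add_norm (by simp)
  refine (hint.const_mul C).mono' (by fun_prop) (Eventually.of_forall fun t => ?_)
  rw [Real.norm_of_nonneg (by positivity)]
  have h1 : Real.exp (-2 * |t|) ≤ (1 + ‖t‖) ^ (-(2 : ℝ)) := by
    rw [Real.rpow_neg (by positivity), Real.norm_eq_abs, neg_mul, Real.exp_neg]
    have : (1 + |t|) ^ (2 : ℝ) ≤ Real.exp (2 * |t|) := by
      rw [two_mul, Real.exp_add, ← sq, Real.rpow_two]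
      have := Real.add_one_le_exp |t|
      gcongr
      linarith
    gcongr
  calc Real.exp (K * |t|) * ‖g t‖
      ≤ Real.exp (K * |t|) * (C * Real.exp (-(K + 2) * |t|)) := by gcongr; exact hC t
    _ = C * (Real.exp (K * |t|) * Real.exp (-(K + 2) * |t|)) := by ring
    _ = C * Real.exp (-2 * |t|) := by rw [← Real.exp_add]; ring_nf
    _ ≤ _ := by gcongr

lemma of_hasCompactSupport (hg : Continuous g) (h : HasCompactSupport g) : HasExpMoments g := by
  refine ⟨hg.aestronglyMeasurable, fun K => ?_⟩
  exact (by fun_prop : Continuous fun t : ℝ => Real.exp (K * |t|) * ‖g t‖)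
    |>.integrable_of_hasCompactSupport h.norm.mul_left

end HasExpMoments

/-! ### Paley–Wiener decay for compactly supported smooth functions -/

section Decay

variable {φ : ℝ → ℂ}

lemma fourierLaplace_deriv (hφ : ContDiff ℝ ∞ φ) (hc : HasCompactSupport φ) (w : ℂ) :
    fourierLaplace (deriv φ) w = Complex.I * w * fourierLaplace φ w := by
  have hd : ∀ t : ℝ, HasDerivAt (fun t : ℝ => Complex.exp (-Complex.I * w * (t : ℂ)))
      (Complex.exp (-Complex.I * w * (t : ℂ)) * (-Complex.I * w)) t := fun t => by
    have h : HasDerivAt (fun t : ℝ => -Complex.I * w * (t : ℂ)) (-Complex.I * w) t := by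
      simpa using (Complex.ofRealCLM.hasDerivAt (x := t)).const_mul (-Complex.I * w)
    exact h.cexp
  have hφ' : Continuous (deriv φ) := hφ.continuous_deriv (by simp)
  have hm := HasExpMoments.of_hasCompactSupport hφ.continuous hc
  have hm' := HasExpMoments.of_hasCompactSupport hφ' hc.deriv
  have h := integral_mul_deriv_eq_deriv_mul_of_integrable (u := fun t : ℝ =>
    Complex.exp (-Complex.I * w * (t : ℂ))) (v := φ) (v' := deriv φ)
    (u' := fun t => Complex.exp (-Complex.I * w * (t : ℂ)) * (-Complex.I * w))
    (fun t _ => hd t) (fun t _ => (hφ.differentiable (by simp) t).hasDerivAt)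
    (hm'.integrable_kernel_mul w)
    (((hm.integrable_kernel_mul w).const_mul (-Complex.I * w)).congr
      (Eventually.of_forall fun t => by simp only [Pi.mul_apply]; ring))
    (hm.integrable_kernel_mul w)
  rw [fourierLaplace, h, fourierLaplace, ← integral_neg, ← integral_const_mul]
  congr 1 with t
  ring

lemma norm_fourierLaplace_le (hφ : Continuous φ) (hc : HasCompactSupport φ) {w : ℂ} {M : ℝ}
    (hM : ∀ t ∈ tsupport φ, Real.exp (w.im * t) ≤ M) :
    ‖fourierLaplace φ w‖ ≤ (∫ t, ‖φ t‖) * M := by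
  rw [← integral_mul_const]
  refine norm_integral_le_of_norm_le
    ((hφ.norm.integrable_of_hasCompactSupport hc.norm).mul_const M)
    (Eventually.of_forall fun t => ?_)
  rw [norm_mul, norm_exp_kernel, mul_comm]
  by_cases ht : t ∈ tsupport φ
  · gcongr; exact hM t ht
  · simp [image_eq_zero_of_notMem_tsupport ht]

/-- Each integration by parts trades a derivative of `φ` for a factor `w`. The bound `M` stays a
parameter, so that it can be `1` on a half-plane for support in `t < 0`, or a uniform constant on a
strip. -/
lemma exists_fourierLaplace_decay (k : ℕ) : ∀ {φ : ℝ → ℂ}, ContDiff ℝ ∞ φ →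
    HasCompactSupport φ → ∃ C : ℝ, ∀ (w : ℂ) (M : ℝ),
      (∀ t ∈ tsupport φ, Real.exp (w.im * t) ≤ M) →
        (1 + ‖w‖) ^ k * ‖fourierLaplace φ w‖ ≤ C * M := by
  induction k with
  | zero =>
    intro φ hφ hc
    exact ⟨∫ t, ‖φ t‖, fun w M hM => by
      simpa using norm_fourierLaplace_le hφ.continuous hc hM⟩
  | succ k ih =>
    intro φ hφ hc
    have hφ' : ContDiff ℝ ∞ (deriv φ) := by
      simpa using hφ.iterate_deriv 1
    obtain ⟨C, hC⟩ := ih hφ hc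
    obtain ⟨C', hC'⟩ := ih hφ' hc.deriv
    refine ⟨C + C', fun w M hM => ?_⟩
    have h1 := hC w M hM
    have h2 := hC' w M fun t ht => hM t (tsupport_deriv_subset ht)
    rw [fourierLaplace_deriv hφ hc, norm_mul, norm_mul, Complex.norm_I, one_mul] at h2
    calc (1 + ‖w‖) ^ (k + 1) * ‖fourierLaplace φ w‖
        = (1 + ‖w‖) ^ k * ‖fourierLaplace φ w‖ +
          (1 + ‖w‖) ^ k * (‖w‖ * ‖fourierLaplace φ w‖) := by ring
      _ ≤ (C + C') * M := by linarith

end Decay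

/-! ### Contour shifts -/

lemma integrable_inv_one_add_norm_sq : Integrable fun x : ℝ => ((1 + ‖x‖) ^ 2)⁻¹ := by
  have := integrable_one_add_norm (E := ℝ) (μ := volume) (r := 2) (by simp)
  refine this.congr (Eventually.of_forall fun x => ?_)
  simp only
  rw [Real.rpow_neg (by positivity), Real.rpow_two]

/-- Shifting the line of integration of a function holomorphic in a horizontal strip. -/
lemma integral_horizontal_shift {F : ℂ → ℂ} {b C : ℝ}
    (hcont : ContinuousOn F (Complex.im ⁻¹' uIcc 0 b))
    (hdiff : DifferentiableOn ℂ F (Complex.im ⁻¹' Ioo (min 0 b) (max 0 b)))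
    (hbound : ∀ z : ℂ, z.im ∈ uIcc 0 b → (1 + ‖z‖) ^ 2 * ‖F z‖ ≤ C) :
    ∫ a : ℝ, F a = ∫ a : ℝ, F (a + b * Complex.I) := by
  have hline : ∀ y ∈ uIcc 0 b, Integrable fun a : ℝ => F (a + y * Complex.I) := fun y hy => by
    have hc : Continuous fun a : ℝ => F (a + y * Complex.I) := by
      refine hcont.comp_continuous (by fun_prop) fun a => ?_
      simpa using hy
    refine (integrable_inv_one_add_norm_sq.const_mul C).mono' hc.aestronglyMeasurable
      (Eventually.of_forall fun a => ?_)
    have h := hbound (a + y * Complex.I) (by simpa using hy)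
    have h1 : ‖a‖ ≤ ‖(a + y * Complex.I : ℂ)‖ := by
      simpa using Complex.abs_re_le_norm (a + y * Complex.I : ℂ)
    rw [← div_eq_mul_inv, le_div_iff₀' (by positivity)]
    refine le_trans ?_ h
    gcongr
  have hC : 0 ≤ C := by
    refine le_trans ?_ (hbound 0 (by simp))
    positivity
  -- Taking `s R = R` and `s R = -R` handles both vertical sides of the Cauchy rectangle.
  have hside : ∀ (s : ℝ → ℝ), (∀ R, |R| ≤ |s R|) →
      Tendsto (fun R : ℝ => ∫ y : ℝ in (0 : ℝ)..b, F (s R + y * Complex.I)) atTop (𝓝 0) := by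
    intro s hs
    have hlim : Tendsto (fun R : ℝ => C * ((1 + |R|) ^ 2)⁻¹ * |b - 0|) atTop (𝓝 0) := by
      have h1 : Tendsto (fun R : ℝ => (1 + |R|) ^ 2) atTop atTop :=
        (tendsto_pow_atTop two_ne_zero).comp
          (tendsto_atTop_add_const_left _ _ tendsto_abs_atTop_atTop)
      simpa using (h1.inv_tendsto_atTop.const_mul C).mul_const |b - 0|
    refine squeeze_zero_norm (fun R => ?_) hlim
    refine intervalIntegral.norm_integral_le_of_norm_le_const fun y hy => ?_
    have hy' : y ∈ uIcc 0 b := uIoc_subset_uIcc hy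
    have h := hbound (s R + y * Complex.I) (by simpa using hy')
    have h1 : |R| ≤ ‖(s R + y * Complex.I : ℂ)‖ := by
      simpa using (hs R).trans (by simpa using Complex.abs_re_le_norm (s R + y * Complex.I : ℂ))
    rw [← div_eq_mul_inv, le_div_iff₀' (by positivity)]
    refine le_trans ?_ h
    gcongr
  have hrect : ∀ R : ℝ, (∫ x : ℝ in (-R)..R, F x) - (∫ x : ℝ in (-R)..R, F (x + b * Complex.I)) =
      Complex.I • (∫ y : ℝ in (0 : ℝ)..b, F ((-R : ℝ) + y * Complex.I)) -
      Complex.I • (∫ y : ℝ in (0 : ℝ)..b, F ((R : ℝ) + y * Complex.I)) := fun R => by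
    have h := Complex.integral_boundary_rect_eq_zero_of_continuousOn_of_differentiableOn F
      ((-R : ℝ) : ℂ) (R + b * Complex.I) (hcont.mono fun z hz => by simpa using hz.2)
      (hdiff.mono fun z hz => by simpa using hz.2)
    simp only [Complex.ofReal_re, Complex.ofReal_im, Complex.add_re, Complex.add_im,
      Complex.mul_re, Complex.mul_im, Complex.I_re, Complex.I_im, mul_zero, mul_one, zero_mul,
      sub_zero, add_zero, zero_add, Complex.ofReal_zero] at h
    linear_combination h
  have h0 := hline 0 (by simp)
  simp only [Complex.ofReal_zero, zero_mul, add_zero] at h0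
  have hl := (intervalIntegral_tendsto_integral h0 tendsto_neg_atTop_atBot tendsto_id).sub
    (intervalIntegral_tendsto_integral (hline b (by simp)) tendsto_neg_atTop_atBot tendsto_id)
  have hr := ((hside (fun R => -R) (by simp)).const_smul Complex.I).sub
    ((hside (fun R => R) (by simp)).const_smul Complex.I)
  simp only [smul_zero, sub_zero] at hr
  exact sub_eq_zero.mp (tendsto_nhds_unique (hl.congr fun R => hrect R) hr)

/-- Shift the line to height `b`: two of the three powers of decay give integrability along the
line, and the third leaves a factor `(1 + b)⁻¹`, which tends to zero. -/
lemma integral_eq_zero_of_upper_halfPlane {F : ℂ → ℂ} {C : ℝ}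
    (hcont : ContinuousOn F {z | 0 ≤ z.im}) (hdiff : DifferentiableOn ℂ F {z | 0 < z.im})
    (hbound : ∀ z : ℂ, 0 ≤ z.im → (1 + ‖z‖) ^ 3 * ‖F z‖ ≤ C) :
    ∫ a : ℝ, F a = 0 := by
  have hle : ∀ b : ℝ, 0 ≤ b →
      ‖∫ a : ℝ, F a‖ ≤ (∫ a : ℝ, C * ((1 + ‖a‖) ^ 2)⁻¹) * (1 + b)⁻¹ := fun b hb => by
    have hu : ∀ z : ℂ, z.im ∈ uIcc 0 b → 0 ≤ z.im := fun z hz => by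
      rw [uIcc_of_le hb] at hz; exact hz.1
    rw [integral_horizontal_shift (F := F) (b := b) (C := C) (hcont.mono hu)
      (hdiff.mono fun z hz => by simpa [hb] using hz.1)
      fun z hz => le_trans (by gcongr <;> simp) (hbound z (hu z hz)), ← integral_mul_const]
    refine norm_integral_le_of_norm_le
      ((integrable_inv_one_add_norm_sq.const_mul C).mul_const _)
      (Eventually.of_forall fun a => ?_)
    have h := hbound (a + b * Complex.I) (by simpa using hb)
    have h1 : ‖a‖ ≤ ‖(a + b * Complex.I : ℂ)‖ := by
      simpa using Complex.abs_re_le_norm (a + b * Complex.I : ℂ)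
    have h2 : b ≤ ‖(a + b * Complex.I : ℂ)‖ := by
      simpa [abs_of_nonneg hb] using Complex.abs_im_le_norm (a + b * Complex.I : ℂ)
    rw [mul_assoc, ← mul_inv, ← div_eq_mul_inv, le_div_iff₀' (by positivity)]
    refine le_trans ?_ h
    rw [pow_succ (1 + ‖(a + b * Complex.I : ℂ)‖) 2]
    gcongr
  have hlim : Tendsto (fun b : ℝ => (∫ a : ℝ, C * ((1 + ‖a‖) ^ 2)⁻¹) * (1 + b)⁻¹)
      atTop (𝓝 0) := by
    simpa using (tendsto_atTop_add_const_left _ (1 : ℝ) tendsto_id).inv_tendsto_atTop.const_mul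
      (∫ a : ℝ, C * ((1 + ‖a‖) ^ 2)⁻¹)
  refine norm_le_zero_iff.mp (ge_of_tendsto hlim ?_)
  filter_upwards [eventually_ge_atTop 0] with b hb using hle b hb

/-! ### Causality from an extension to the upper half-plane -/

lemma angularFourier_ofFunction_apply {f : ℝ → ℂ} (hf : IsSlowlyIncreasing f) (φ : 𝓢(ℝ, ℂ)) :
    angularFourier (ofFunction f hf) φ =
      (Real.sqrt (2 * Real.pi) : ℂ)⁻¹ * ∫ y : ℝ, f y * fourierLaplace φ y := by
  rw [angularFourier_apply, ofFunction_apply, ← integral_const_mul]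
  congr 1 with y
  rw [angularFourierSchwartz_apply, fourierLaplace]
  ring

/-- The Fourier transform of the boundary value of a polynomially bounded holomorphic function on
the upper half-plane is causal. -/
theorem isCausal_of_holomorphic_extension {f : ℝ → ℂ} (hf : IsSlowlyIncreasing f) {F : ℂ → ℂ}
    {n : ℕ} (hfF : ∀ y : ℝ, F y = f y) (hcont : ContinuousOn F {z | 0 ≤ z.im})
    (hdiff : DifferentiableOn ℂ F {z | 0 < z.im})
    (hbound : ∀ z : ℂ, 0 ≤ z.im → ‖F z‖ ≤ (1 + ‖z‖) ^ n) :
    IsCausal (angularFourier (ofFunction f hf)) := by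
  intro x hx
  by_contra hx0
  rw [mem_Ici, not_le] at hx0
  refine absurd hx ((Distribution.notMem_dsupport_iff x).mpr
    -- A bounded neighbourhood of `x < 0` inside the negative axis, so every test function supported
    -- in it has compact support.
    ⟨Ioo (2 * x) (x / 2), fun u hu => ?_, isOpen_Ioo, by constructor <;> linarith⟩)
  have hc : HasCompactSupport u :=
    isCompact_Icc.of_isClosed_subset (isClosed_tsupport _) (hu.trans Ioo_subset_Icc_self)
  have hm := HasExpMoments.of_hasCompactSupport u.continuous hc
  -- `n` powers offset the growth of `F`; the other three feed the contour shift.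
  obtain ⟨C, hC⟩ := exists_fourierLaplace_decay (n + 3) (u.smooth ⊤) hc
  rw [angularFourier_ofFunction_apply]
  simp_rw [← hfF]
  rw [integral_eq_zero_of_upper_halfPlane (F := fun z => F z * fourierLaplace u z) (C := C)
    (hcont.mul hm.differentiable_fourierLaplace.continuous.continuousOn)
    (hdiff.mul hm.differentiable_fourierLaplace.differentiableOn) fun z hz => ?_, mul_zero]
  have h := hC z 1 fun t ht => by
    rw [Real.exp_le_one_iff]
    exact mul_nonpos_of_nonneg_of_nonpos hz (by linarith [(hu ht).2])
  rw [mul_one] at h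
  refine le_trans ?_ h
  rw [norm_mul, pow_add, mul_comm (_ ^ n) (_ ^ 3), mul_assoc]
  gcongr
  exact hbound z hz

/-! ### Uniqueness and the non-causality criterion -/

lemma eq_zero_of_fourierLaplace_eq_zero {g : ℝ → ℂ} (hg : HasExpMoments g) (hc : Continuous g)
    (h : ∀ t : ℝ, fourierLaplace g t = 0) : g = 0 := by
  have h0 : 𝓕 g = 0 := by
    ext w
    rw [Real.fourier_real_eq_integral_exp_smul, Pi.zero_apply, ← h (2 * Real.pi * w),
      fourierLaplace]
    congr 1 with t
    rw [smul_eq_mul]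
    congr 2
    push_cast
    ring
  have hinv := hc.fourierInv_fourier_eq hg.integrable_self
    (by rw [h0]; exact integrable_zero ℝ ℂ volume)
  rw [← hinv, h0]
  ext w
  simp [Real.fourierInv_eq]

/-- Continuity upgrades almost everywhere to everywhere on `s`; the identity theorem for the entire
transform spreads the zero to all of `ℂ`, and Fourier inversion gives `g = 0`. -/
lemma eq_zero_of_fourierLaplace_ae_eq_zero {g : ℝ → ℂ} (hg : HasExpMoments g)
    (hc : Continuous g) {s : Set ℝ} (hs : IsOpen s) (hne : s.Nonempty)
    (h : ∀ᵐ t : ℝ, t ∈ s → fourierLaplace g t = 0) : g = 0 := by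
  have hd := hg.differentiable_fourierLaplace
  have hcont : Continuous fun t : ℝ => fourierLaplace g t :=
    hd.continuous.comp Complex.continuous_ofReal
  have hzero : EqOn (fun t : ℝ => fourierLaplace g t) 0 s := by
    refine Measure.eqOn_open_of_ae_eq (μ := volume) ?_ hs hcont.continuousOn continuousOn_const
    exact (ae_restrict_iff' hs.measurableSet).mpr h
  obtain ⟨t₀, ht₀⟩ := hne
  have hfreq : ∃ᶠ z in 𝓝[≠] (t₀ : ℂ), fourierLaplace g z = (fun _ => 0) z := by
    have htend : Tendsto (fun t : ℝ => (t : ℂ)) (𝓝[≠] t₀) (𝓝[≠] (t₀ : ℂ)) := by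
      refine tendsto_nhdsWithin_iff.mpr
        ⟨Complex.continuous_ofReal.continuousAt.tendsto.mono_left nhdsWithin_le_nhds, ?_⟩
      filter_upwards [self_mem_nhdsWithin] with t ht
      simpa using ht
    have hev : ∀ᶠ t in 𝓝[≠] t₀, fourierLaplace g (t : ℝ) = 0 :=
      eventually_nhdsWithin_of_eventually_nhds
        ((hs.eventually_mem ht₀).mono fun t ht => hzero ht)
    exact htend.frequently hev.frequently
  have hall := AnalyticOnNhd.eq_of_frequently_eq (fun z _ => hd.analyticAt z)
    (fun z _ => analyticAt_const) hfreq
  exact eq_zero_of_fourierLaplace_eq_zero hg hc fun t => congrFun hall t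

/-- Fubini together with `exp(-i(a+ib)t) = exp(bt) exp(-iat)`. -/
lemma integral_mul_fourierLaplace_shift {g φ : ℝ → ℂ} (hg : HasExpMoments g) (hgc : Continuous g)
    (hφ : Continuous φ) (hc : HasCompactSupport φ) (b : ℝ) :
    ∫ a : ℝ, g a * fourierLaplace φ (a + b * Complex.I) =
      ∫ t : ℝ, φ t * (Complex.exp (b * t) * fourierLaplace g t) := by
  have hφb : Integrable fun t : ℝ => Complex.exp (b * t) * φ t :=
    (by fun_prop : Continuous fun t : ℝ => Complex.exp (b * t) * φ t)
      |>.integrable_of_hasCompactSupport hc.mul_left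
  have hint : Integrable (Function.uncurry fun a t : ℝ =>
      (g a * (Complex.exp (b * t) * φ t)) * Complex.exp (-Complex.I * a * t))
      (volume.prod volume) := by
    refine (hg.integrable_self.mul_prod hφb).norm.mono' ?_ (Eventually.of_forall fun p => ?_)
    · exact (by fun_prop : Continuous fun p : ℝ × ℝ =>
        (g p.1 * (Complex.exp (b * p.2) * φ p.2)) * Complex.exp (-Complex.I * p.1 * p.2))
          |>.aestronglyMeasurable
    · rw [Function.uncurry, norm_mul, norm_exp_kernel]
      simp
  calc ∫ a : ℝ, g a * fourierLaplace φ (a + b * Complex.I)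
      = ∫ a : ℝ, ∫ t : ℝ,
          (g a * (Complex.exp (b * t) * φ t)) * Complex.exp (-Complex.I * a * t) := by
        congr 1 with a
        rw [fourierLaplace, ← integral_const_mul]
        congr 1 with t
        have : Complex.exp (-Complex.I * (a + b * Complex.I) * t) =
            Complex.exp (b * t) * Complex.exp (-Complex.I * a * t) := by
          rw [← Complex.exp_add]
          congr 1
          linear_combination (-(b * t : ℂ)) * Complex.I_mul_I
        rw [this]
        ring
    _ = ∫ t : ℝ, ∫ a : ℝ,
          (g a * (Complex.exp (b * t) * φ t)) * Complex.exp (-Complex.I * a * t) :=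
        integral_integral_swap hint
    _ = _ := by
        congr 1 with t
        rw [fourierLaplace, ← mul_assoc, ← integral_const_mul]
        congr 1 with a
        rw [mul_right_comm (-Complex.I)]
        ring

/-- A function extending holomorphically and boundedly to a horizontal strip, with nonzero
superexponentially decaying values on the other edge, has a non-causal Fourier transform. -/
theorem not_isCausal_of_strip_extension {f : ℝ → ℂ} (hf : IsSlowlyIncreasing f) {F : ℂ → ℂ}
    {b C : ℝ} (hfF : ∀ y : ℝ, F y = f y) (hcont : ContinuousOn F (Complex.im ⁻¹' uIcc 0 b))
    (hdiff : DifferentiableOn ℂ F (Complex.im ⁻¹' Ioo (min 0 b) (max 0 b)))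
    (hbound : ∀ z : ℂ, z.im ∈ uIcc 0 b → ‖F z‖ ≤ C)
    (hexp : ∀ K : ℝ, ∃ C : ℝ, ∀ a : ℝ, ‖F (a + b * Complex.I)‖ ≤ C * Real.exp (-K * |a|))
    (hne : ∃ a : ℝ, F (a + b * Complex.I) ≠ 0) :
    ¬ IsCausal (angularFourier (ofFunction f hf)) := by
  intro hcausal
  have hgc : Continuous fun a : ℝ => F (a + b * Complex.I) :=
    hcont.comp_continuous (by fun_prop) fun a => by simp
  have hg := HasExpMoments.of_exp_bound hgc hexp
  -- Any negative point would do.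
  have hnot : (-1 : ℝ) ∉ Distribution.dsupport (angularFourier (ofFunction f hf)) := fun h => by
    have := hcausal h
    norm_num at this
  obtain ⟨s, hvan, hs, hmem⟩ := (Distribution.notMem_dsupport_iff _).mp hnot
  have hcl : Continuous fun t : ℝ => fourierLaplace (fun a : ℝ => F (a + b * Complex.I)) t :=
    hg.differentiable_fourierLaplace.continuous.comp Complex.continuous_ofReal
  have hae : ∀ᵐ t : ℝ, t ∈ s →
      Complex.exp (b * t) * fourierLaplace (fun a : ℝ => F (a + b * Complex.I)) t = 0 := by
    refine hs.ae_eq_zero_of_integral_contDiff_smul_eq_zero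
      ((by fun_prop : Continuous fun t : ℝ => Complex.exp (b * t) *
        fourierLaplace (fun a : ℝ => F (a + b * Complex.I)) t)
      |>.locallyIntegrable.locallyIntegrableOn s) fun u hu huc hus => ?_
    have hφc : HasCompactSupport (Complex.ofRealCLM ∘ u) := huc.comp_left rfl
    have hφ : ContDiff ℝ ∞ (Complex.ofRealCLM ∘ u) := Complex.ofRealCLM.contDiff.comp hu
    have hT := hvan (hφc.toSchwartzMap hφ) ((tsupport_comp_subset (map_zero Complex.ofRealCLM) u).trans hus)
    rw [angularFourier_ofFunction_apply] at hT
    have hpi : (Real.sqrt (2 * Real.pi) : ℂ)⁻¹ ≠ 0 := by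
      have := Real.sqrt_pos.mpr Real.two_pi_pos
      exact inv_ne_zero (by exact_mod_cast this.ne')
    replace hT := (mul_eq_zero.mp hT).resolve_left hpi
    obtain ⟨C', hC'⟩ := exists_fourierLaplace_decay 2 hφ hφc
    -- `M` dominates `exp(t Im z)` on the support of the test function, uniformly over the strip.
    obtain ⟨M, hM⟩ := hφc.exists_bound_of_continuousOn
      (f := fun t : ℝ => Real.exp (|b| * |t|)) (by fun_prop)
    have hm := (HasExpMoments.of_hasCompactSupport hφ.continuous
      hφc).differentiable_fourierLaplace
    have hshift := integral_horizontal_shift (C := C * (C' * M))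
      (F := fun z => F z * fourierLaplace (Complex.ofRealCLM ∘ u) z) (b := b)
      (hcont.mul hm.continuous.continuousOn) (hdiff.mul hm.differentiableOn) fun z hz => by
        have h := hC' z M fun t ht => by
          refine le_trans ?_ (hM t ht)
          rw [Real.norm_of_nonneg (Real.exp_nonneg _), Real.exp_le_exp]
          have hzb : |z.im| ≤ |b| := by simpa using abs_sub_left_of_mem_uIcc hz
          calc z.im * t ≤ |z.im| * |t| := by rw [← abs_mul]; exact le_abs_self _
            _ ≤ _ := by gcongr
        rw [norm_mul, mul_left_comm]
        exact mul_le_mul (hbound z hz) h (by positivity)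
          ((norm_nonneg _).trans (hbound z hz))
    simp only [hfF] at hshift
    rw [integral_mul_fourierLaplace_shift hg hgc hφ.continuous hφc b] at hshift
    simpa [Complex.real_smul] using hshift.symm.trans hT
  obtain ⟨a, ha⟩ := hne
  refine ha (congrFun (eq_zero_of_fourierLaplace_ae_eq_zero hg hgc hs ⟨_, hmem⟩ ?_) a)
  filter_upwards [hae] with t ht hts
  exact (mul_eq_zero.mp (ht hts)).resolve_left (Complex.exp_ne_zero _)

/-! ### Causal symbols: powers, and exponentials with `γ ≤ 1` -/

section HalfPlane

variable {γ : ℝ}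

/-- On this set `-iz` has nonnegative real part, so it meets the closed branch cut only at `0`,
where `γ > 0` gives continuity. -/
lemma continuousOn_upperHalfPlane_cpow (hγ : 0 < γ) :
    ContinuousOn (fun z : ℂ => (-Complex.I * z) ^ (γ : ℂ)) {z | 0 ≤ z.im} := by
  intro z hz
  have h : ContinuousAt (fun w : ℂ => w ^ (γ : ℂ)) (-Complex.I * z) :=
    Complex.continuousAt_cpow_const_of_re_pos (Or.inl (by simpa using hz)) (by simpa using hγ)
  exact (ContinuousAt.comp (f := fun z : ℂ => -Complex.I * z) h (by fun_prop)).continuousWithinAt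

lemma differentiableOn_upperHalfPlane_cpow :
    DifferentiableOn ℂ (fun z : ℂ => (-Complex.I * z) ^ (γ : ℂ)) {z | 0 < z.im} := by
  intro z hz
  have h : DifferentiableAt ℂ (fun z : ℂ => -Complex.I * z) z := by fun_prop
  exact (h.cpow_const (Or.inl (by simpa using hz))).differentiableWithinAt

lemma isCausal_powerSymbol (hγ : 0 < γ) :
    IsCausal (angularFourier
      (ofFunction (powerSymbol γ) (isSlowlyIncreasing_powerSymbol hγ))) := by
  refine isCausal_of_holomorphic_extension _ (n := ⌈γ⌉₊) (fun y => rfl)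
    (continuousOn_upperHalfPlane_cpow hγ) differentiableOn_upperHalfPlane_cpow fun z _ => ?_
  rw [Complex.norm_cpow_real, norm_mul, norm_neg, Complex.norm_I, one_mul, ← Real.rpow_natCast]
  calc ‖z‖ ^ γ ≤ (1 + ‖z‖) ^ γ := by gcongr; linarith
    _ ≤ _ := Real.rpow_le_rpow_of_exponent_le (by linarith [norm_nonneg z]) (Nat.le_ceil γ)

/-- The argument lies in `[-π/2, π/2]`, and scaling by `γ ≤ 1` keeps it there. -/
lemma re_cpow_nonneg {w : ℂ} (hw : 0 ≤ w.re) (hγ : 0 ≤ γ) (hγ1 : γ ≤ 1) :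
    0 ≤ (w ^ (γ : ℂ)).re := by
  rw [Complex.cpow_ofReal_re]
  have h := Complex.abs_arg_le_pi_div_two_iff.mpr hw
  have h2 : |w.arg * γ| ≤ Real.pi / 2 := by
    rw [abs_mul, abs_of_nonneg hγ]
    exact (mul_le_of_le_one_right (abs_nonneg _) hγ1).trans h
  exact mul_nonneg (by positivity) (Real.cos_nonneg_of_mem_Icc (abs_le.mp h2))

lemma cosSign_of_le_one (hγ : 0 < γ) (hγ1 : γ ≤ 1) : cosSign γ = 1 := by
  unfold cosSign
  split_ifs with h
  · rfl
  · refine Real.sign_of_pos (lt_of_le_of_ne (Real.cos_nonneg_of_mem_Icc ⟨?_, ?_⟩) (Ne.symm h))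
    · nlinarith [Real.pi_pos]
    · nlinarith [Real.pi_pos]

lemma isCausal_attenuationSymbol (hγ : 0 < γ) (hγ1 : γ ≤ 1) {r : ℝ} (hr : 0 ≤ r) :
    IsCausal (angularFourier
      (ofFunction (attenuationSymbol γ r) (isSlowlyIncreasing_attenuationSymbol hγ hr))) := by
  refine isCausal_of_holomorphic_extension _ (n := 0)
    (F := fun z => Complex.exp (-(cosSign γ : ℂ) * (-Complex.I * z) ^ (γ : ℂ) * (r : ℂ)))
    (fun y => rfl)
    ((continuousOn_const.mul (continuousOn_upperHalfPlane_cpow hγ)).mul continuousOn_const).cexp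
    ((differentiableOn_upperHalfPlane_cpow.const_mul _).mul_const _).cexp fun z hz => ?_
  have h : 0 ≤ ((-Complex.I * z) ^ (γ : ℂ)).re :=
    re_cpow_nonneg (by simpa using hz) hγ.le hγ1
  rw [cosSign_of_le_one hγ hγ1, Complex.norm_exp, pow_zero, Real.exp_le_one_iff,
    Complex.re_mul_ofReal, Complex.ofReal_one, neg_one_mul, Complex.neg_re]
  nlinarith

end HalfPlane

/-! ### Non-causal symbols: exponentials with `γ > 1` -/

section NonCausal

lemma norm_attenuationSymbol {γ : ℝ} (hγ : 0 < γ) (r y : ℝ) :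
    ‖attenuationSymbol γ r y‖ =
      Real.exp (-(cosSign γ * Real.cos (Real.pi / 2 * γ) * r * |y| ^ γ)) := by
  rw [attenuationSymbol, Complex.norm_exp, Complex.re_mul_ofReal, ← Complex.ofReal_neg,
    Complex.re_ofReal_mul, powerSymbol_re hγ]
  ring_nf

lemma cosSign_mul_cos_pos {γ : ℝ} (h : Real.cos (Real.pi / 2 * γ) ≠ 0) :
    0 < cosSign γ * Real.cos (Real.pi / 2 * γ) := by
  rw [cosSign, if_neg h]
  exact Real.sign_mul_pos_of_ne_zero _ h

lemma exists_linear_le_rpow {γ c : ℝ} (hγ : 1 < γ) (hc : 0 < c) (K : ℝ) :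
    ∃ D : ℝ, ∀ x : ℝ, 0 ≤ x → K * x ≤ c * x ^ γ + D := by
  obtain ⟨M, hM⟩ := eventually_atTop.mp
    ((tendsto_rpow_atTop (sub_pos.mpr hγ)).eventually_ge_atTop (K / c))
  refine ⟨|K| * |M|, fun x hx => ?_⟩
  rcases le_total M x with h | h
  · have h1 := hM x h
    rw [div_le_iff₀ hc] at h1
    have h2 : x ^ γ = x ^ (γ - 1) * x := by
      rcases hx.eq_or_lt with rfl | hx
      · rw [mul_zero, Real.zero_rpow (by linarith)]
      · rw [← Real.rpow_add_one hx.ne', sub_add_cancel]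
    have h3 : K * x ≤ x ^ (γ - 1) * c * x := by gcongr
    rw [h2]
    nlinarith [mul_nonneg (abs_nonneg K) (abs_nonneg M)]
  · have h1 : K * x ≤ |K| * |M| :=
      mul_le_mul (le_abs_self K) (h.trans (le_abs_self M)) hx (abs_nonneg K)
    have : 0 ≤ c * x ^ γ := by positivity
    linarith

lemma continuous_powerSymbol {γ : ℝ} (hγ : 0 < γ) : Continuous (powerSymbol γ) :=
  (continuousOn_upperHalfPlane_cpow hγ).comp_continuous Complex.continuous_ofReal fun y => by simp

lemma continuous_attenuationSymbol {γ : ℝ} (hγ : 0 < γ) (r : ℝ) :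
    Continuous (attenuationSymbol γ r) := by
  have := continuous_powerSymbol hγ
  unfold attenuationSymbol
  fun_prop

lemma not_isCausal_attenuationSymbol_of_cos_ne_zero {γ : ℝ} (hγ : 0 < γ) (hγ1 : 1 < γ)
    (hcos : Real.cos (Real.pi / 2 * γ) ≠ 0) {r : ℝ} (hr : 0 < r) :
    ¬ IsCausal (angularFourier
      (ofFunction (attenuationSymbol γ r) (isSlowlyIncreasing_attenuationSymbol hγ hr.le))) := by
  -- The strip degenerates to the real line: its interior is empty, so holomorphy is vacuous and `F`
  -- only has to be continuous.
  refine not_isCausal_of_strip_extension _ (F := fun z => attenuationSymbol γ r z.re) (b := 0)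
    (C := 1) (fun y => rfl)
    ((continuous_attenuationSymbol hγ r).comp Complex.continuous_re).continuousOn
    (by simp [DifferentiableOn]) (fun z _ => norm_attenuationSymbol_le hγ hr.le _) (fun K => ?_)
    ⟨0, Complex.exp_ne_zero _⟩
  obtain ⟨D, hD⟩ := exists_linear_le_rpow hγ1 (mul_pos (cosSign_mul_cos_pos hcos) hr) K
  refine ⟨Real.exp D, fun a => ?_⟩
  rw [norm_attenuationSymbol hγ, ← Real.exp_add, Real.exp_le_exp]
  have := hD |a| (abs_nonneg a)
  simp only [Complex.ofReal_zero, zero_mul, add_zero, Complex.ofReal_re]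
  linarith

/-- First-order Taylor expansion in the imaginary direction. In the induction, the remainder is
multiplied by `a + iy` and gains one explicit quadratic term. -/
lemma exists_pow_linear_approx (m : ℕ) : ∃ C : ℝ, 0 ≤ C ∧ ∀ a y : ℝ, |y| ≤ 1 →
    ‖((a : ℂ) + y * Complex.I) ^ (m + 2) - (a : ℂ) ^ (m + 2) -
      (m + 2) * (a : ℂ) ^ (m + 1) * (y * Complex.I)‖ ≤ C * y ^ 2 * (1 + |a|) ^ m := by
  induction m with
  | zero =>
    refine ⟨1, zero_le_one, fun a y _ => le_of_eq ?_⟩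
    have : ((a : ℂ) + y * Complex.I) ^ (0 + 2) - (a : ℂ) ^ (0 + 2) -
        ((0 : ℕ) + 2) * (a : ℂ) ^ (0 + 1) * (y * Complex.I) = (y * Complex.I) ^ 2 := by
      push_cast; ring
    rw [this]
    simp
  | succ m ih =>
    obtain ⟨C, hC0, hC⟩ := ih
    refine ⟨C + (m + 2), by positivity, fun a y hy => ?_⟩
    have hE := hC a y hy
    set E : ℂ := ((a : ℂ) + y * Complex.I) ^ (m + 2) - (a : ℂ) ^ (m + 2) -
      (m + 2) * (a : ℂ) ^ (m + 1) * (y * Complex.I) with hEdef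
    have hstep : ((a : ℂ) + y * Complex.I) ^ (m + 1 + 2) - (a : ℂ) ^ (m + 1 + 2) -
        ((m + 1 : ℕ) + 2) * (a : ℂ) ^ (m + 1 + 1) * (y * Complex.I) =
        (a + y * Complex.I) * E + (m + 2 : ℕ) * (a : ℂ) ^ (m + 1) * (y * Complex.I) ^ 2 := by
      rw [hEdef]; push_cast; ring
    rw [hstep]
    have h1 : ‖(a : ℂ) + y * Complex.I‖ ≤ 1 + |a| := by
      refine (norm_add_le _ _).trans ?_
      simp only [norm_mul, Complex.norm_real, Complex.norm_I, Real.norm_eq_abs]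
      linarith
    have h2 : ‖((m + 2 : ℕ) : ℂ) * (a : ℂ) ^ (m + 1) * (y * Complex.I) ^ 2‖ ≤
        (m + 2) * (1 + |a|) ^ (m + 1) * y ^ 2 := by
      simp only [norm_mul, norm_pow, Complex.norm_real, Complex.norm_I, Real.norm_eq_abs,
        Complex.norm_natCast, mul_one, sq_abs]
      push_cast
      gcongr
      linarith
    calc _ ≤ ‖(a : ℂ) + y * Complex.I‖ * ‖E‖ + _ := (norm_add_le _ _).trans
          (add_le_add (norm_mul_le _ _) h2)
      _ ≤ (1 + |a|) * (C * y ^ 2 * (1 + |a|) ^ m) + (m + 2) * (1 + |a|) ^ (m + 1) * y ^ 2 := by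
          gcongr
      _ = _ := by ring

lemma exists_lower_order_le_pow {m : ℕ} (hm : 1 ≤ m) {C K : ℝ} (hC : 0 ≤ C) (hK : 0 ≤ K) :
    ∃ D : ℝ, 0 ≤ D ∧ ∀ x : ℝ, 0 ≤ x → K * x + C * (1 + x) ^ m ≤ x ^ (m + 1) + D := by
  -- Beyond `M` the left side is at most `(C * 2 ^ m + K) * x ^ m ≤ x ^ (m + 1)`; below `M` it is
  -- bounded by its value at `M`.
  set M := 1 + (C * 2 ^ m + K)
  have hM : 1 ≤ M := by
    have : 0 ≤ C * 2 ^ m + K := by positivity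
    simp only [M]; linarith
  refine ⟨K * M + C * (1 + M) ^ m, by positivity, fun x hx => ?_⟩
  rcases le_total x M with h | h
  · have h1 : K * x + C * (1 + x) ^ m ≤ K * M + C * (1 + M) ^ m := by gcongr
    have : 0 ≤ x ^ (m + 1) := by positivity
    linarith
  · have hx1 : 1 ≤ x := hM.trans h
    have h1 : (1 + x) ^ m ≤ 2 ^ m * x ^ m := by
      rw [← mul_pow]; gcongr; linarith
    have h2 : x ≤ x ^ m := le_self_pow₀ hx1 (by omega)
    have h3 : (C * 2 ^ m + K) * x ^ m ≤ x * x ^ m := by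
      gcongr
      simp only [M] at h; linarith
    have h4 : C * (1 + x) ^ m ≤ C * (2 ^ m * x ^ m) := by gcongr
    have h5 : K * x ≤ K * x ^ m := by gcongr
    have h6 : 0 ≤ K * M + C * (1 + M) ^ m := by positivity
    rw [pow_succ]
    nlinarith

lemma re_neg_I_mul_pow_odd (z : ℂ) (k : ℕ) :
    ((-Complex.I * z) ^ (2 * k + 1)).re = (-1) ^ k * (z ^ (2 * k + 1)).im := by
  have h : (-Complex.I) ^ (2 * k + 1) = (((-1) ^ k : ℝ) : ℂ) * (-Complex.I) := by
    rw [pow_succ, pow_mul, neg_sq, Complex.I_sq]; push_cast; rfl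
  rw [mul_pow, h, mul_assoc, Complex.re_ofReal_mul]
  simp

/-- On the strip of height one adjacent to the real axis on the side given by the sign `(-1)^k`,
the real part of `(-iz)^(2k+1)` grows superlinearly. -/
lemma exists_re_pow_odd_lower_bound {k : ℕ} (hk : 1 ≤ k) {K : ℝ} (hK : 0 ≤ K) :
    ∃ D : ℝ, 0 ≤ D ∧ ∀ a β : ℝ, 0 ≤ β → β ≤ 1 →
      β * (K * |a| - D) ≤
        ((-Complex.I * (a + ((-1) ^ k * β : ℝ) * Complex.I)) ^ (2 * k + 1)).re := by
  obtain ⟨j, rfl⟩ : ∃ j, k = j + 1 := ⟨k - 1, by omega⟩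
  obtain ⟨C, hC0, hC⟩ := exists_pow_linear_approx (2 * j + 1)
  obtain ⟨D, hD0, hD⟩ := exists_lower_order_le_pow (m := 2 * j + 1) (by omega) hC0 hK
  refine ⟨D, hD0, fun a β hβ0 hβ1 => ?_⟩
  rw [re_neg_I_mul_pow_odd]
  -- With this sign the linear Taylor term contributes `(2j+3) |a|^(2j+2) β ≥ 0` to the real part;
  -- the remainder has lower degree in `|a|`.
  set y : ℝ := (-1) ^ (j + 1) * β with hy
  have hsq : ((-1 : ℝ) ^ (j + 1)) * (-1) ^ (j + 1) = 1 := by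
    rw [← mul_pow]; simp
  have hyβ : (-1 : ℝ) ^ (j + 1) * y = β := by rw [hy, ← mul_assoc, hsq, one_mul]
  have hyabs : |y| = β := by rw [hy, abs_mul, abs_pow, abs_neg, abs_one, one_pow, one_mul,
    abs_of_nonneg hβ0]
  have hE := (Complex.abs_im_le_norm _).trans (hC a y (hyabs.trans_le hβ1))
  have him : (((a : ℂ) + y * Complex.I) ^ (2 * j + 1 + 2) - (a : ℂ) ^ (2 * j + 1 + 2) -
      ((2 * j + 1 : ℕ) + 2) * (a : ℂ) ^ (2 * j + 1 + 1) * (y * Complex.I)).im =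
      (((a : ℂ) + y * Complex.I) ^ (2 * (j + 1) + 1)).im -
        (2 * j + 3) * a ^ (2 * j + 2) * y := by
    have e1 : (((2 * j + 1 : ℕ) + 2) * (a : ℂ) ^ (2 * j + 1 + 1) * (y * Complex.I) : ℂ) =
        (((2 * j + 3) * a ^ (2 * j + 2) * y : ℝ) : ℂ) * Complex.I := by
      push_cast; ring
    rw [e1, ← Complex.ofReal_pow, Complex.sub_im, Complex.sub_im, Complex.ofReal_im,
      Complex.im_ofReal_mul, Complex.I_im]
    ring_nf
  rw [him, ← sq_abs y, hyabs] at hE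
  set P := (((a : ℂ) + y * Complex.I) ^ (2 * (j + 1) + 1)).im
  have hs : |(-1 : ℝ) ^ (j + 1)| = 1 := by rw [abs_pow, abs_neg, abs_one, one_pow]
  have hlow : -(C * β ^ 2 * (1 + |a|) ^ (2 * j + 1)) ≤
      (-1) ^ (j + 1) * P - (2 * j + 3) * |a| ^ (2 * j + 2) * β := by
    have e : (-1) ^ (j + 1) * P - (2 * j + 3) * |a| ^ (2 * j + 2) * β =
        (-1) ^ (j + 1) * (P - (2 * j + 3) * a ^ (2 * j + 2) * y) := by
      rw [mul_sub, ← mul_assoc ((-1 : ℝ) ^ (j + 1)), mul_comm ((-1 : ℝ) ^ (j + 1)) (_ * _),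
        mul_assoc _ ((-1 : ℝ) ^ (j + 1)), hyβ, Even.pow_abs ⟨j + 1, by ring⟩]
    rw [e]
    refine (abs_le.mp ?_).1
    rw [abs_mul, hs, one_mul]
    exact hE
  have hDa := hD |a| (abs_nonneg a)
  have h1 : C * β ^ 2 * (1 + |a|) ^ (2 * j + 1) ≤ β * (C * (1 + |a|) ^ (2 * j + 1)) := by
    -- Here `β ≤ 1` lets the quadratic remainder carry a single factor `β`, matching the main term.
    have : β ^ 2 ≤ β := by nlinarith
    calc _ ≤ C * β * (1 + |a|) ^ (2 * j + 1) := by gcongr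
      _ = _ := by ring
  have h2 : |a| ^ (2 * j + 2) * β ≤ (2 * j + 3) * |a| ^ (2 * j + 2) * β := by
    have : 0 ≤ |a| ^ (2 * j + 2) * β := by positivity
    have hj : (0 : ℝ) ≤ j := j.cast_nonneg
    nlinarith
  have h3 : β * (K * |a| + C * (1 + |a|) ^ (2 * j + 1)) ≤ β * (|a| ^ (2 * j + 2) + D) := by
    gcongr
  linarith

/-- The zeros of the cosine make `γ` an odd integer, so the principal power becomes an entire
monomial; `γ > 1` excludes `k = 0`, where the growth off the axis would fail. -/
lemma exists_eq_odd_of_cos_eq_zero {γ : ℝ} (hγ1 : 1 < γ)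
    (hcos : Real.cos (Real.pi / 2 * γ) = 0) : ∃ k : ℕ, 1 ≤ k ∧ γ = (2 * k + 1 : ℕ) := by
  obtain ⟨n, hn⟩ := Real.cos_eq_zero_iff.mp hcos
  have hγ : γ = 2 * n + 1 := by
    have := Real.pi_pos.ne'
    field_simp at hn
    linarith
  have hn0 : 0 < n := by
    have : (0 : ℝ) < n := by linarith
    exact_mod_cast this
  refine ⟨n.toNat, by omega, ?_⟩
  have : ((n.toNat : ℤ) : ℝ) = n := by rw [Int.toNat_of_nonneg hn0.le]
  push_cast at this ⊢
  rw [hγ, this]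

lemma not_isCausal_attenuationSymbol_of_cos_eq_zero {γ : ℝ} (hγ : 0 < γ) (hγ1 : 1 < γ)
    (hcos : Real.cos (Real.pi / 2 * γ) = 0) {r : ℝ} (hr : 0 < r) :
    ¬ IsCausal (angularFourier
      (ofFunction (attenuationSymbol γ r) (isSlowlyIncreasing_attenuationSymbol hγ hr.le))) := by
  obtain ⟨k, hk, hγk⟩ := exists_eq_odd_of_cos_eq_zero hγ1 hcos
  set F : ℂ → ℂ := fun z => Complex.exp (-(-Complex.I * z) ^ (2 * k + 1) * (r : ℂ)) with hF
  have hnorm : ∀ z, ‖F z‖ = Real.exp (-(((-Complex.I * z) ^ (2 * k + 1)).re * r)) := fun z => by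
    rw [hF, Complex.norm_exp, Complex.re_mul_ofReal, Complex.neg_re, neg_mul]
  have hd : Differentiable ℂ F := by
    rw [hF]; fun_prop
  have hs : ((-1 : ℝ) ^ k) * (-1) ^ k = 1 := by rw [← mul_pow]; simp
  -- The case `K = 0` suffices for boundedness on the strip; superexponential decay on the far edge
  -- uses `K = |K| / r` below.
  obtain ⟨D, hD0, hD⟩ := exists_re_pow_odd_lower_bound hk le_rfl
  refine not_isCausal_of_strip_extension _ (F := F) (b := (-1) ^ k) (C := Real.exp (D * r))
    (fun y => ?_) hd.continuous.continuousOn hd.differentiableOn (fun z hz => ?_) (fun K => ?_)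
    ⟨0, Complex.exp_ne_zero _⟩
  · rw [attenuationSymbol, powerSymbol, cosSign, if_pos hcos, hγk, Complex.ofReal_natCast,
      Complex.cpow_natCast, Complex.ofReal_one, neg_one_mul]
  -- `β` is the distance to the real axis, whichever side the strip lies on.
  · obtain ⟨β, hβ0, hβ1, hβ⟩ : ∃ β : ℝ, 0 ≤ β ∧ β ≤ 1 ∧ z.im = (-1) ^ k * β := by
      refine ⟨(-1) ^ k * z.im, ?_⟩
      rcases neg_one_pow_eq_or ℝ k with h | h <;> rw [h] at hz ⊢
      · rw [uIcc_of_le zero_le_one] at hz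
        exact ⟨by linarith [hz.1], by linarith [hz.2], by ring⟩
      · rw [uIcc_of_ge (by norm_num)] at hz
        exact ⟨by linarith [hz.2], by linarith [hz.1], by ring⟩
    have h := hD z.re β hβ0 hβ1
    rw [← hβ, Complex.re_add_im] at h
    rw [hnorm, Real.exp_le_exp, ← neg_mul]
    gcongr
    nlinarith
  · obtain ⟨D', hD'0, hD'⟩ := exists_re_pow_odd_lower_bound hk (K := |K| / r) (by positivity)
    refine ⟨Real.exp (D' * r), fun a => ?_⟩
    have h := hD' a 1 zero_le_one le_rfl
    rw [mul_one, one_mul] at h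
    rw [hnorm, ← Real.exp_add, Real.exp_le_exp]
    have h1 := mul_le_mul_of_nonneg_right h hr.le
    have h2 : (|K| / r * |a| - D') * r = |K| * |a| - D' * r := by field_simp
    have h3 : K * |a| ≤ |K| * |a| := by gcongr; exact le_abs_self K
    rw [h2] at h1
    linarith

end NonCausal

end CausalDistribution

end

theorem mainTheorem2 (γ : ℝ) (hγ : 0 < γ) (x : EuclideanSpace ℝ (Fin 3)) :
    IsCausal (angularFourier (ofFunction (powerSymbol γ) (isSlowlyIncreasing_powerSymbol hγ))) ∧
    (γ ≤ 1 → IsCausal (angularFourier (ofFunction (attenuationSymbol γ ‖x‖)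
      (isSlowlyIncreasing_attenuationSymbol hγ (norm_nonneg x))))) ∧
    (1 < γ → x ≠ 0 → ¬ IsCausal (angularFourier (ofFunction (attenuationSymbol γ ‖x‖)
      (isSlowlyIncreasing_attenuationSymbol hγ (norm_nonneg x))))) := by
  refine ⟨isCausal_powerSymbol hγ, fun hγ1 => isCausal_attenuationSymbol hγ hγ1 (norm_nonneg x),
    fun hγ1 hx => ?_⟩
  have hr : 0 < ‖x‖ := norm_pos_iff.mpr hx
  by_cases hcos : Real.cos (Real.pi / 2 * γ) = 0
  · exact not_isCausal_attenuationSymbol_of_cos_eq_zero hγ hγ1 hcos hr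
  · exact not_isCausal_attenuationSymbol_of_cos_ne_zero hγ hγ1 hcos hr
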